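/- Let $k$ be a field, $S=k[x_1,\dots,x_N]$, let $\mathfrak a=\langle m_1,\dots,m_l\rangle\subseteq S$ be an ideal generated by monomials $m_1,\dots,m_l$, and let $A=S/\mathfrak a$. Let $K^A$ be the Koszul complex of $A$ with respect to the residue classes of $x_1,\dots,x_N$, a differential graded algebra with differential $\partial$, and let $H_\bullet(K^A)$ be its homology. Call $A$ Golod if all Massey operations on $H_\bullet(K^A)$ vanish, that is, if there are a homogeneous $k$-basis $B$ of $\bigoplus_{p\ge 1}H_p(K^A)$ and a function $\gamma$ assigning to each nonempty finite sequence $(h_1,\dots,h_r)$ in $B$ a homogeneous element $\gamma(h_1,\dots,h_r)\in K^A$ of degree $|h_1|+\dots+|h_r|+r-1$ such that $\gamma(h)$ is a cycle representing $h$ for every $h\in B$, and $$\partial\gamma(h_1,\dots,h_r)=\sum_{j=1}^{r-1}(-1)^{|\gamma(h_1,\dots,h_j)|+1}\,\gamma(h_1,\dots,h_j)\,\gamma(h_{j+1},\dots,h_r)\qquad\text{for } r\ge 2 .$$ (If $\mathfrak a\subseteq(x_1,\dots,x_N)^2$, this is the usual Golod property of the ring $A$.) Let $\mathrm{MinGen}(\mathfrak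 a)$ be the minimal monomial generating system of $\mathfrak a$, i.e. the set of monomials in $\mathfrak a$ that are minimal with respect to divisibility. If $A$ is Golod, then $\mathfrak a$ satisfies the gcd-condition: for any two distinct monomials $m,n\in\mathrm{MinGen}(\mathfrak a)$ with $\gcd(m,n)=1$ there is a monomial $u\in\mathrm{MinGen}(\mathfrak a)$ with $u\ne m$, $u\ne n$ and $u\mid\operatorname{lcm}(m,n)$. -/

import Mathlib

open MvPolynomial

noncomputable section

/-- The Koszul complex of a commutative ring `A` with respect to a sequence `x₁, …, xₙ`, as a
graded algebra: the exterior algebra on the free module with basis `e₁, …, eₙ`. Its component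
`K_p` of homological degree `p` is `⋀[A]^p (Fin n → A)`. -/
abbrev KoszulAlgebra (A : Type*) [CommRing A] (n : ℕ) : Type _ :=
  ExteriorAlgebra A (Fin n → A)

/-- The Koszul differential, contraction with the linear form `e_i ↦ x_i`; that is,
`∂ (e_{j₁} ∧ ⋯ ∧ e_{jᵢ}) = ∑ₗ (-1)^(l+1) x_{jₗ} e_{j₁} ∧ ⋯ (omit e_{jₗ}) ⋯ ∧ e_{jᵢ}`. -/
def koszulDiff {A : Type*} [CommRing A] {n : ℕ} (x : Fin n → A) :
    KoszulAlgebra A n →ₗ[A] KoszulAlgebra A n :=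
  CliffordAlgebra.contractLeft (Fintype.linearCombination A x)

/-- The cycles `Z_p` of the Koszul complex. -/
def koszulCycles {A : Type*} [CommRing A] {n : ℕ} (x : Fin n → A) (p : ℕ) :
    Submodule A (KoszulAlgebra A n) :=
  (⋀[A]^p (Fin n → A)) ⊓ LinearMap.ker (koszulDiff x)

/-- The boundaries `B_p = ∂ K_{p+1}` of the Koszul complex. -/
def koszulBoundaries {A : Type*} [CommRing A] {n : ℕ} (x : Fin n → A) (p : ℕ) :
    Submodule A (KoszulAlgebra A n) :=
  (⋀[A]^(p + 1) (Fin n → A)).map (koszulDiff x)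

/-- The Koszul homology `H_p = Z_p / B_p`. -/
abbrev KoszulHomology {A : Type*} [CommRing A] {n : ℕ} (x : Fin n → A) (p : ℕ) : Type _ :=
  koszulCycles x p ⧸ (koszulBoundaries x p).submoduleOf (koszulCycles x p)

/-- The homological degree `|h₁| + ⋯ + |hᵣ| + r - 1` of the value of a Massey operation at
`(h₁, …, hᵣ)`, `r ≥ 1`, where `⟨p, h⟩` stands for a class `h` of degree `p + 1`. -/
def masseyDegree {B : ℕ → Type*} (L : List (Σ p, B p)) : ℕ :=
  (L.map fun h => h.1 + 1).sum + (L.length - 1)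

/-- The Koszul complex of the `k`-algebra `A` with respect to `x₁, …, xₙ` admits a trivial Massey
operation (all Massey operations vanish): there are a homogeneous `k`-basis `B = ⋃ₚ B p` of
`⨁_{p ≥ 1} H_p`, with `B p` a basis of `H_{p+1}`, and a function `γ` from the nonempty finite
sequences in `B` to the Koszul complex such that `γ(h)` is a cycle with class `h` and
`∂ γ(h₁, …, hᵣ) = ∑_{j=1}^{r-1} \bar{γ(h₁, …, hⱼ)} γ(h_{j+1}, …, hᵣ)` for `r ≥ 2`, where
`\bar{c} = (-1)^(|c|+1) c`. (The value of `γ` at the empty sequence is irrelevant.) -/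
def HasTrivialMasseyOperation (k : Type*) [Field k] {A : Type*} [CommRing A] [Algebra k A]
    {n : ℕ} (x : Fin n → A) : Prop :=
  ∃ B : ∀ p : ℕ, Set (KoszulHomology x (p + 1)),
    (∀ p, LinearIndepOn k id (B p) ∧ Submodule.span k (B p) = ⊤) ∧
    ∃ γ : List (Σ p, B p) → KoszulAlgebra A n,
      (∀ (p : ℕ) (h : B p), ∃ hz : γ [⟨p, h⟩] ∈ koszulCycles x (p + 1),
        Submodule.Quotient.mk ⟨γ [⟨p, h⟩], hz⟩ = (h : KoszulHomology x (p + 1))) ∧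
      ∀ L : List (Σ p, B p), 2 ≤ L.length →
        γ L ∈ ⋀[A]^(masseyDegree L) (Fin n → A) ∧
        koszulDiff x (γ L) = ∑ j ∈ Finset.Ico 1 L.length,
          (-1 : A) ^ (masseyDegree (L.take j) + 1) • (γ (L.take j) * γ (L.drop j))

/-- The algebra `A = k[x₁, …, xₙ]/a` is Golod: all Massey operations on the homology of the Koszul
complex of `A` with respect to the residue classes of `x₁, …, xₙ` vanish. -/
def IsGolodQuotient {k : Type*} [Field k] {n : ℕ} (a : Ideal (MvPolynomial (Fin n) k)) : Prop :=
  HasTrivialMasseyOperation k (fun i : Fin n => Ideal.Quotient.mk a (X i))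

/-- The minimal monomial generating system of a monomial ideal `a`, as a set of exponent vectors:
the monomials of `a` that are minimal with respect to divisibility. -/
def minGen {k : Type*} [Field k] {n : ℕ} (a : Ideal (MvPolynomial (Fin n) k)) :
    Set (Fin n →₀ ℕ) :=
  {s | Minimal (fun t => monomial t (1 : k) ∈ a) s}

/-- The gcd-condition. In terms of exponent vectors, divisibility of monomials is `≤`, the greatest
common divisor is `⊓`, the least common multiple is `⊔`, and the monomial `1` is `0`. -/
def SatisfiesGCDCondition {k : Type*} [Field k] {n : ℕ} (a : Ideal (MvPolynomial (Fin n) k)) :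
    Prop :=
  ∀ s ∈ minGen a, ∀ t ∈ minGen a, s ≠ t → s ⊓ t = 0 →
    ∃ u ∈ minGen a, u ≠ s ∧ u ≠ t ∧ u ≤ s ⊔ t

end

/-! ### Products of 1-cycles under a trivial Massey operation. -/

section KoszulAlgebra

variable {A : Type*} [CommRing A] {n : ℕ} (x : Fin n → A)

/-! Suppose coprime minimal generators `s ≠ t` violate the condition, so that no third minimal
generator divides x^(s+t). For i in supp s and j in supp t, x^(s-e_i) e_i and x^(t-e_j) e_j are
1-cycles, and the case r = 2 of the Massey relation makes their product a boundary
(`HasTrivialMasseyOperation.mul_mem_range`).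

A linear functional on Koszul chains contradicts this. It sums, over p in supp s and q in supp t,
the coefficient of x^(s+t) in x_p x_q times the coordinate at e_p ∧ e_q. It is well defined modulo
`a` because only `s` and `t` can divide x^(s+t) (`coeff_X_mul_X_mul_eq_zero`), it kills boundaries
by antisymmetry (`sum_koszulCoord₂_koszulDiff_eq_zero`), and its value on the product is 1
(`mul_ι_single_notMem_range`). -/

theorem koszulDiff_mul (a b : KoszulAlgebra A n) :
    koszulDiff x (a * b) = koszulDiff x a * b + CliffordAlgebra.involute a * koszulDiff x b := by
  unfold koszulDiff
  induction a using CliffordAlgebra.left_induction with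
  | algebraMap r =>
    rw [CliffordAlgebra.contractLeft_algebraMap_mul, CliffordAlgebra.contractLeft_algebraMap,
      zero_mul, zero_add, AlgHom.commutes]
  | add a₁ a₂ h₁ h₂ => simp only [add_mul, map_add, h₁, h₂]; abel
  | ι_mul a v h =>
    rw [mul_assoc, CliffordAlgebra.contractLeft_ι_mul, h, CliffordAlgebra.contractLeft_ι_mul,
      map_mul, CliffordAlgebra.involute_ι, mul_add, sub_mul, smul_mul_assoc]
    simp only [neg_mul, mul_assoc]
    abel

theorem koszulDiff_ι (v : Fin n → A) :
    koszulDiff x (ExteriorAlgebra.ι A v) = algebraMap A _ (∑ i, v i * x i) := by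
  refine (CliffordAlgebra.contractLeft_ι _ _ _).trans ?_
  simp [Fintype.linearCombination_apply]

theorem koszulDiff_eq_sum (ω : KoszulAlgebra A n) :
    koszulDiff x ω = ∑ r, x r •
      CliffordAlgebra.contractLeft (LinearMap.proj r : (Fin n → A) →ₗ[A] A) ω := by
  have h : Fintype.linearCombination A x =
      ∑ r, x r • (LinearMap.proj r : (Fin n → A) →ₗ[A] A) := by
    ext i
    simp [Fintype.linearCombination_apply, Pi.single_apply]
  rw [koszulDiff, h]
  simp [LinearMap.sum_apply]

theorem ι_mem_koszulCycles {v : Fin n → A} (hv : ∑ i, v i * x i = 0) :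
    ExteriorAlgebra.ι A v ∈ koszulCycles x 1 := by
  refine ⟨?_, ?_⟩
  · show _ ∈ LinearMap.range (ExteriorAlgebra.ι A) ^ 1
    rw [pow_one]
    exact ⟨v, rfl⟩
  · rw [SetLike.mem_coe, LinearMap.mem_ker, koszulDiff_ι, hv, map_zero]

theorem mul_mem_range_koszulDiff_of_left {b w : KoszulAlgebra A n}
    (hb : b ∈ LinearMap.range (koszulDiff x)) (hw : koszulDiff x w = 0) :
    b * w ∈ LinearMap.range (koszulDiff x) := by
  obtain ⟨c, rfl⟩ := hb
  exact ⟨c * w, by rw [koszulDiff_mul, hw, mul_zero, add_zero]⟩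

/-- A cycle z of degree 1 is negated by the grading involution, so z ∂c = ∂(-z c). -/
theorem mul_mem_range_koszulDiff_of_right {z b : KoszulAlgebra A n}
    (hz : z ∈ koszulCycles x 1) (hb : b ∈ LinearMap.range (koszulDiff x)) :
    z * b ∈ LinearMap.range (koszulDiff x) := by
  obtain ⟨c, rfl⟩ := hb
  obtain ⟨hz₁, hz₂⟩ := hz
  replace hz₁ : z ∈ LinearMap.range (ExteriorAlgebra.ι A) ^ 1 := hz₁
  rw [pow_one] at hz₁
  obtain ⟨v, rfl⟩ := hz₁
  refine ⟨-(ExteriorAlgebra.ι A v * c), ?_⟩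
  rw [map_neg, koszulDiff_mul, LinearMap.mem_ker.1 hz₂, zero_mul, zero_add]
  have : CliffordAlgebra.involute (ExteriorAlgebra.ι A v) = -ExteriorAlgebra.ι A v :=
    CliffordAlgebra.involute_ι _
  rw [this, neg_mul, neg_neg]

/-- A `k`-linear property of cycles that holds for boundaries and for representatives of a
spanning set of the homology holds for all cycles. -/
theorem koszulCycles_le_of_span (k : Type*) [Field k] [Algebra k A] {p : ℕ}
    {B : Set (KoszulHomology x p)} (hB : Submodule.span k B = ⊤)
    (P : Submodule k (KoszulAlgebra A n))
    (hP : ∀ b ∈ koszulBoundaries x p, b ∈ P)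
    (hrep : ∀ h ∈ B, ∃ c, ∃ hc : c ∈ koszulCycles x p, c ∈ P ∧
      (Submodule.Quotient.mk ⟨c, hc⟩ : KoszulHomology x p) = h)
    {z : KoszulAlgebra A n} (hz : z ∈ koszulCycles x p) : z ∈ P := by
  have key : ∀ h ∈ Submodule.span k B, ∃ c : koszulCycles x p, (c : KoszulAlgebra A n) ∈ P ∧
      (Submodule.Quotient.mk c : KoszulHomology x p) = h := by
    intro h hh
    induction hh using Submodule.span_induction with
    | mem h hh =>
      obtain ⟨c, hc, h₁, h₂⟩ := hrep h hh
      exact ⟨⟨c, hc⟩, h₁, h₂⟩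
    | zero => exact ⟨0, P.zero_mem, rfl⟩
    | add _ _ _ _ h₁ h₂ =>
      obtain ⟨c₁, h₁, rfl⟩ := h₁
      obtain ⟨c₂, h₂, rfl⟩ := h₂
      exact ⟨c₁ + c₂, P.add_mem h₁ h₂, rfl⟩
    | smul r _ _ h₁ =>
      obtain ⟨c₁, h₁, rfl⟩ := h₁
      exact ⟨r • c₁, P.smul_mem r h₁, rfl⟩
  obtain ⟨c, hc, h⟩ := key (Submodule.Quotient.mk ⟨z, hz⟩) (hB ▸ Submodule.mem_top)
  have hb := (Submodule.Quotient.eq _).1 h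
  have hb' : (c : KoszulAlgebra A n) - z ∈ koszulBoundaries x p := hb
  simpa using P.sub_mem hc (hP _ hb')

theorem koszulBoundaries_le_range {p : ℕ} {b : KoszulAlgebra A n}
    (hb : b ∈ koszulBoundaries x p) : b ∈ LinearMap.range (koszulDiff x) := by
  obtain ⟨c, -, rfl⟩ := hb
  exact ⟨c, rfl⟩

/-- A trivial Massey operation makes the product of two cycles of degree `1` a boundary. -/
theorem HasTrivialMasseyOperation.mul_mem_range {k : Type*} [Field k] [Algebra k A]
    (h : HasTrivialMasseyOperation k x) {z w : KoszulAlgebra A n}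
    (hz : z ∈ koszulCycles x 1) (hw : w ∈ koszulCycles x 1) :
    z * w ∈ LinearMap.range (koszulDiff x) := by
  obtain ⟨B, hB, γ, hγ, hM⟩ := h
  let R : Submodule k (KoszulAlgebra A n) := (LinearMap.range (koszulDiff x)).restrictScalars k
  have hγγ (g h : B 0) : γ [⟨0, g⟩] * γ [⟨0, h⟩] ∈ R := by
    have e := (hM [⟨0, g⟩, ⟨0, h⟩] le_rfl).2
    simp only [List.length_cons, List.length_nil, zero_add, Nat.reduceAdd] at e
    rw [show Finset.Ico 1 2 = {1} from rfl, Finset.sum_singleton] at e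
    simp only [List.take_succ_cons, List.take_zero, List.drop_succ_cons, List.drop_zero] at e
    rcases neg_one_pow_eq_or A (masseyDegree [(⟨0, g⟩ : Σ p, B p)] + 1) with h1 | h1
    · rw [h1, one_smul] at e
      exact ⟨_, e⟩
    · rw [h1, neg_one_smul] at e
      exact ⟨-_, by rw [map_neg, e, neg_neg]⟩
  -- Bilinear extension from basis representatives to all 1-cycles: first in the right factor, then
  -- in the left.
  have hγw (g : B 0) : γ [⟨0, g⟩] * w ∈ R := by
    refine koszulCycles_le_of_span x k (hB 0).2 (R.comap (LinearMap.mulLeft k (γ [⟨0, g⟩])))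
      (fun b hb => ?_) (fun h hh => ?_) hw
    · exact mul_mem_range_koszulDiff_of_right x (hγ 0 g).1 (koszulBoundaries_le_range x hb)
    · obtain ⟨hc, e⟩ := hγ 0 ⟨h, hh⟩
      exact ⟨_, hc, hγγ _ _, e⟩
  refine koszulCycles_le_of_span x k (hB 0).2 (R.comap (LinearMap.mulRight k w))
      (fun b hb => ?_) (fun h hh => ?_) hz
  · exact mul_mem_range_koszulDiff_of_left x (koszulBoundaries_le_range x hb) hw.2
  · obtain ⟨hc, e⟩ := hγ 0 ⟨h, hh⟩
    exact ⟨_, hc, hγw _, e⟩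

end KoszulAlgebra

/-! ### A functional vanishing on boundaries. -/

section Functional

/-- The terms at (p, q) and (q, p) cancel. The diagonal needs its own hypothesis because of
2-torsion. -/
theorem sum_sum_eq_zero_of_alternating {ι M : Type*} [AddCommGroup M] (P : Finset ι)
    (f : ι → ι → M) (h0 : ∀ p, f p p = 0) (h : ∀ p ∈ P, ∀ q ∈ P, f p q = -f q p) :
    ∑ p ∈ P, ∑ q ∈ P, f p q = 0 := by
  rw [← Finset.sum_product']
  refine Finset.sum_involution (fun a _ => a.swap) ?_ ?_ ?_ ?_
  · rintro ⟨p, q⟩ ha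
    rw [Finset.mem_product] at ha
    simp [h p ha.1 q ha.2]
  · rintro ⟨p, q⟩ _ hne he
    obtain rfl : q = p := congrArg Prod.fst he
    exact hne (h0 _)
  · rintro ⟨p, q⟩ ha
    rw [Finset.mem_product] at ha ⊢
    exact ha.symm
  · rintro ⟨p, q⟩ _
    rfl

variable {A M : Type*} [CommRing A] [AddCommGroup M] {n : ℕ}

/-- The coordinate of a Koszul chain at `e_p ∧ e_q`. -/
def koszulCoord₂ (p q : Fin n) : KoszulAlgebra A n →ₗ[A] A :=
  ExteriorAlgebra.algebraMapInv.toLinearMap ∘ₗ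
    CliffordAlgebra.contractLeft (LinearMap.proj q : (Fin n → A) →ₗ[A] A) ∘ₗ
    CliffordAlgebra.contractLeft (LinearMap.proj p : (Fin n → A) →ₗ[A] A)

theorem koszulCoord₂_ι_mul_ι (p q : Fin n) (v w : Fin n → A) :
    koszulCoord₂ p q (ExteriorAlgebra.ι A v * ExteriorAlgebra.ι A w) = v p * w q - w p * v q := by
  have e (d : Module.Dual A (Fin n → A)) (u : Fin n → A) :
      CliffordAlgebra.contractLeft d (ExteriorAlgebra.ι A u) = algebraMap A _ (d u) :=
    CliffordAlgebra.contractLeft_ι _ _ _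
  have e' (d : Module.Dual A (Fin n → A)) (u : Fin n → A) (b : KoszulAlgebra A n) :
      CliffordAlgebra.contractLeft d (ExteriorAlgebra.ι A u * b) =
        d u • b - ExteriorAlgebra.ι A u * CliffordAlgebra.contractLeft d b :=
    CliffordAlgebra.contractLeft_ι_mul _ _ _
  simp only [koszulCoord₂, LinearMap.comp_apply, e', e, map_sub, map_smul,
    CliffordAlgebra.contractLeft_algebraMap, mul_zero, sub_zero, LinearMap.proj_apply,
    AlgHom.toLinearMap_apply, AlgHom.commutes, smul_eq_mul, Algebra.algebraMap_self, RingHom.id_apply]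
  ring

/-- The functional `∑ φ p q` of the coordinates at `e_p ∧ e_q`, for `p ∈ P` and `q ∈ Q`, vanishes
on boundaries if `φ p q (x_r f)` is symmetric in the indices from `P` and in those from `Q`. -/
theorem sum_koszulCoord₂_koszulDiff_eq_zero (x : Fin n → A) (P Q : Finset (Fin n))
    (hPQ : Disjoint P Q) (φ : Fin n → Fin n → A →+ M)
    (h₁ : ∀ p ∈ P, ∀ q ∈ Q, ∀ r ∈ P, ∀ f, φ p q (x r * f) = φ r q (x p * f))
    (h₂ : ∀ p ∈ P, ∀ q ∈ Q, ∀ r ∈ Q, ∀ f, φ p q (x r * f) = φ p r (x q * f))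
    (h₃ : ∀ p ∈ P, ∀ q ∈ Q, ∀ r, r ∉ P → r ∉ Q → ∀ f, φ p q (x r * f) = 0)
    (ω : KoszulAlgebra A n) :
    ∑ p ∈ P, ∑ q ∈ Q, φ p q (koszulCoord₂ p q (koszulDiff x ω)) = 0 := by
  let c (r : Fin n) := CliffordAlgebra.contractLeft (Q := (0 : QuadraticForm A (Fin n → A)))
    (LinearMap.proj r : (Fin n → A) →ₗ[A] A)
  -- Up to sign, the coordinate of `ω` at e_p ∧ e_q ∧ e_r. It alternates, while `φ p q (x r * ·)` is
  -- symmetric in two indices from the same set, so the terms cancel in pairs.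
  let D (p q r : Fin n) : A := ExteriorAlgebra.algebraMapInv (c q (c p (c r ω)))
  have hDpr (p q r : Fin n) : D p q r = -D r q p := by
    simp only [D, c]
    rw [CliffordAlgebra.contractLeft_comm _ _ ω, map_neg, map_neg]
  have hDpq (p q r : Fin n) : D p q r = -D q p r := by
    simp only [D, c]
    rw [CliffordAlgebra.contractLeft_comm, map_neg]
  have hDqr (p q r : Fin n) : D p q r = -D p r q := by
    rw [hDpq, hDpr, hDpq, neg_neg]
  have hD₁ (p q : Fin n) : D p q p = 0 := by
    simp only [D, c, CliffordAlgebra.contractLeft_contractLeft, map_zero]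
  have hD₂ (p q : Fin n) : D p q q = 0 := by rw [hDpq, hD₁, neg_zero]
  have hsum (p q : Fin n) : φ p q (koszulCoord₂ p q (koszulDiff x ω)) =
      ∑ r, φ p q (x r * D p q r) := by
    rw [koszulDiff_eq_sum, map_sum, map_sum]
    refine Finset.sum_congr rfl fun r _ => ?_
    rw [map_smul, smul_eq_mul]
    rfl
  have hsplit : ∀ p ∈ P, ∀ q ∈ Q, φ p q (koszulCoord₂ p q (koszulDiff x ω)) =
      ∑ r ∈ P, φ p q (x r * D p q r) + ∑ r ∈ Q, φ p q (x r * D p q r) := by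
    intro p hp q hq
    rw [hsum, ← Finset.sum_union hPQ]
    refine (Finset.sum_subset (Finset.subset_univ _) fun r _ hr => ?_).symm
    rw [Finset.mem_union, not_or] at hr
    exact h₃ p hp q hq r hr.1 hr.2 _
  rw [Finset.sum_congr rfl fun p hp => Finset.sum_congr rfl fun q hq => hsplit p hp q hq]
  simp only [Finset.sum_add_distrib]
  rw [Finset.sum_comm, Finset.sum_eq_zero, zero_add, Finset.sum_eq_zero]
  · intro p hp
    refine sum_sum_eq_zero_of_alternating Q (fun q r => φ p q (x r * D p q r))
      (fun q => by rw [hD₂, mul_zero, map_zero]) fun q hq r hr => ?_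
    rw [h₂ p hp q hq r hr, hDqr, mul_neg, map_neg]
  · intro q hq
    refine sum_sum_eq_zero_of_alternating P (fun p r => φ p q (x r * D p q r))
      (fun p => by rw [hD₁, mul_zero, map_zero]) fun p hp r hr => ?_
    rw [h₁ p hp q hq r hr, hDpr, mul_neg, map_neg]

end Functional

/-! ### Coefficients modulo a monomial ideal. -/

section MonomialIdeal

variable {k : Type*} [Field k] {n : ℕ}

theorem monomial_mem_of_mem_support {ι : Type*} {m : ι → (Fin n →₀ ℕ)}
    {a : Ideal (MvPolynomial (Fin n) k)}
    (ha : a = Ideal.span (Set.range fun i => monomial (m i) (1 : k)))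
    {f : MvPolynomial (Fin n) k} (hf : f ∈ a) {v : Fin n →₀ ℕ} (hv : coeff v f ≠ 0) :
    monomial v (1 : k) ∈ a := by
  have h : (Set.range fun i => monomial (m i) (1 : k)) =
      (fun s => monomial s (1 : k)) '' Set.range m := by
    rw [← Set.range_comp]; rfl
  rw [ha, h, mem_ideal_span_monomial_image] at hf ⊢
  intro u hu
  obtain rfl : u = v := by
    simpa using support_monomial_subset hu
  exact hf u (mem_support_iff.2 hv)

/-- Coefficient extraction at the multidegree `d`, after multiplication by `g`, descends to the
quotient by `a` if it vanishes on `a`. -/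
theorem exists_coeff_functional (a : Ideal (MvPolynomial (Fin n) k)) (d : Fin n →₀ ℕ)
    (g : MvPolynomial (Fin n) k) (h : ∀ f ∈ a, coeff d (g * f) = 0) :
    ∃ φ : (MvPolynomial (Fin n) k ⧸ a) →+ k,
      ∀ f, φ (Ideal.Quotient.mk a f) = coeff d (g * f) :=
  ⟨QuotientAddGroup.lift a.toAddSubgroup
    ((lcoeff k d).toAddMonoidHom.comp (AddMonoidHom.mulLeft g)) h, fun _ => rfl⟩

/-- A nonzero coefficient would put x^(s+t-e_p-e_q) in `a`. Its exponents at p and q are s_p - 1 and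
t_q - 1, so neither `s` nor `t` divides it. -/
theorem coeff_X_mul_X_mul_eq_zero {ι : Type*} {m : ι → (Fin n →₀ ℕ)}
    {a : Ideal (MvPolynomial (Fin n) k)}
    (ha : a = Ideal.span (Set.range fun i => monomial (m i) (1 : k)))
    {s t : Fin n →₀ ℕ} (hst : Disjoint s.support t.support)
    (hu : ∀ u ∈ minGen a, u ≤ s + t → u = s ∨ u = t) {p q : Fin n} (hp : p ∈ s.support)
    (hq : q ∈ t.support) {f : MvPolynomial (Fin n) k} (hf : f ∈ a) :
    coeff (s + t) (X p * X q * f) = 0 := by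
  by_contra hne
  rw [mul_assoc, coeff_X_mul', if_pos (by simp_all), coeff_X_mul'] at hne
  split_ifs at hne with hq'
  · obtain ⟨u, hle, hmin⟩ := exists_minimal_le_of_wellFoundedLT
      (fun v => monomial v (1 : k) ∈ a) _ (monomial_mem_of_mem_support ha hf hne)
    have htp : t p = 0 := Finsupp.notMem_support_iff.1 (Finset.disjoint_left.1 hst hp)
    have hsq : s q = 0 := Finsupp.notMem_support_iff.1 (Finset.disjoint_right.1 hst hq)
    have hpq : p ≠ q := by rintro rfl; exact Finset.disjoint_left.1 hst hp hq
    rw [Finsupp.mem_support_iff] at hp hq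
    rcases hu u hmin (hle.trans (tsub_le_self.trans tsub_le_self)) with rfl | rfl
    · have := hle p
      simp [htp, hpq] at this
      omega
    · have := hle q
      simp [hsq, hpq] at this
      omega
  · exact hne rfl

theorem monomial_tsub_single_mul_X {s : Fin n →₀ ℕ} {i : Fin n} (hi : i ∈ s.support) :
    monomial (s - Finsupp.single i 1) (1 : k) * X i = monomial s 1 := by
  rw [X, monomial_mul, mul_one, tsub_add_cancel_of_le]
  rw [Finsupp.mem_support_iff] at hi
  rw [Finsupp.single_le_iff]
  omega

/-- The cycle `x^{s - e_i} e_i` attached to a monomial `x^s` of the ideal. -/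
theorem ι_single_mem_koszulCycles {a : Ideal (MvPolynomial (Fin n) k)} {s : Fin n →₀ ℕ}
    (hs : monomial s (1 : k) ∈ a) {i : Fin n} (hi : i ∈ s.support) :
    ExteriorAlgebra.ι (MvPolynomial (Fin n) k ⧸ a) (Pi.single i
      (Ideal.Quotient.mk a (monomial (s - Finsupp.single i 1) 1))) ∈
      koszulCycles (fun i => Ideal.Quotient.mk a (X i)) 1 := by
  apply ι_mem_koszulCycles
  rw [Finset.sum_eq_single i (fun j _ hj => by simp [hj]) (by simp), Pi.single_eq_same, ← map_mul,
    monomial_tsub_single_mul_X hi, Ideal.Quotient.eq_zero_iff_mem]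
  exact hs

theorem mul_ι_single_notMem_range {ι : Type*} {m : ι → (Fin n →₀ ℕ)}
    {a : Ideal (MvPolynomial (Fin n) k)}
    (ha : a = Ideal.span (Set.range fun i => monomial (m i) (1 : k)))
    {s t : Fin n →₀ ℕ} (hst : Disjoint s.support t.support)
    (hu : ∀ u ∈ minGen a, u ≤ s + t → u = s ∨ u = t) {i j : Fin n} (hi : i ∈ s.support)
    (hj : j ∈ t.support) :
    ExteriorAlgebra.ι (MvPolynomial (Fin n) k ⧸ a) (Pi.single i
        (Ideal.Quotient.mk a (monomial (s - Finsupp.single i 1) 1))) *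
      ExteriorAlgebra.ι (MvPolynomial (Fin n) k ⧸ a) (Pi.single j
        (Ideal.Quotient.mk a (monomial (t - Finsupp.single j 1) 1))) ∉
      LinearMap.range (koszulDiff fun i => Ideal.Quotient.mk a (X i)) := by
  rintro ⟨ω, hω⟩
  have hex (p q : Fin n) : ∃ φ : (MvPolynomial (Fin n) k ⧸ a) →+ k,
      p ∈ s.support → q ∈ t.support →
        ∀ f, φ (Ideal.Quotient.mk a f) = coeff (s + t) (X p * X q * f) := by
    -- Outside the two supports the coefficient functional need not descend to the quotient; 0 is a
    -- filler value.
    by_cases hpq : p ∈ s.support ∧ q ∈ t.support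
    · obtain ⟨φ, hφ⟩ := exists_coeff_functional a (s + t) (X p * X q)
        fun f hf => coeff_X_mul_X_mul_eq_zero ha hst hu hpq.1 hpq.2 hf
      exact ⟨φ, fun _ _ => hφ⟩
    · exact ⟨0, fun hp hq => absurd ⟨hp, hq⟩ hpq⟩
  choose φ hφ using hex
  have hzero := sum_koszulCoord₂_koszulDiff_eq_zero (fun i => Ideal.Quotient.mk a (X i))
    s.support t.support hst φ ?_ ?_ ?_ ω
  · rw [hω, Finset.sum_eq_single i, Finset.sum_eq_single j] at hzero
    · have hij : i ≠ j := by rintro rfl; exact Finset.disjoint_left.1 hst hi hj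
      rw [koszulCoord₂_ι_mul_ι, Pi.single_eq_same, Pi.single_eq_same,
        Pi.single_eq_of_ne hij, zero_mul, sub_zero, ← map_mul, hφ i j hi hj,
        show (X i * X j * (monomial (s - Finsupp.single i 1) 1 *
          monomial (t - Finsupp.single j 1) 1) : MvPolynomial (Fin n) k) =
          (monomial (s - Finsupp.single i 1) 1 * X i) *
          (monomial (t - Finsupp.single j 1) 1 * X j) by ring,
        monomial_tsub_single_mul_X hi, monomial_tsub_single_mul_X hj, monomial_mul,
        coeff_monomial, if_pos rfl, mul_one] at hzero
      exact one_ne_zero hzero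
    · intro q hq hqj
      have hqi : q ≠ i := by rintro rfl; exact Finset.disjoint_left.1 hst hi hq
      rw [koszulCoord₂_ι_mul_ι]
      simp [hqj, hqi]
    · exact fun h => absurd hj h
    · intro p hp hpi
      have hpj : p ≠ j := by rintro rfl; exact Finset.disjoint_left.1 hst hp hj
      refine Finset.sum_eq_zero fun q _ => ?_
      rw [koszulCoord₂_ι_mul_ι]
      simp [hpj, hpi]
    · exact fun h => absurd hi h
  · intro p hp q hq r hr f
    obtain ⟨f, rfl⟩ := Ideal.Quotient.mk_surjective f
    rw [← map_mul, ← map_mul, hφ p q hp hq, hφ r q hr hq]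
    congr 1
    ring
  · intro p hp q hq r hr f
    obtain ⟨f, rfl⟩ := Ideal.Quotient.mk_surjective f
    rw [← map_mul, ← map_mul, hφ p q hp hq, hφ p r hp hr]
    congr 1
    ring
  · intro p hp q hq r hrs hrt f
    obtain ⟨f, rfl⟩ := Ideal.Quotient.mk_surjective f
    -- For r outside both supports, x_r does not divide x^(s+t).
    rw [← map_mul, hφ p q hp hq, mul_left_comm, coeff_X_mul', if_neg]
    simp_all

end MonomialIdeal

theorem mainTheorem10 {k : Type*} [Field k] {n l : ℕ} (m : Fin l → (Fin n →₀ ℕ))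
    (a : Ideal (MvPolynomial (Fin n) k))
    (ha : a = Ideal.span (Set.range fun i => MvPolynomial.monomial (m i) (1 : k)))
    (hG : IsGolodQuotient a) : SatisfiesGCDCondition a := by
  intro s hs t ht hne hst
  by_contra! hno
  have hdisj : Disjoint s.support t.support := by
    rw [← Finsupp.disjoint_iff, disjoint_iff]
    exact hst
  have hsup : s ⊔ t = s + t := by
    ext i
    have := DFunLike.congr_fun hst i
    simp only [Finsupp.inf_apply, Finsupp.coe_zero, Pi.zero_apply, Finsupp.sup_apply,
      Finsupp.add_apply] at this ⊢
    omega
  -- The generator 1 would divide the other one, against its minimality.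
  have hsupp {s t : Fin n →₀ ℕ} (ht : t ∈ minGen a) (hs : s ∈ minGen a) (hne : s ≠ t) :
      s.support.Nonempty := by
    rw [Finsupp.support_nonempty_iff]
    rintro rfl
    exact hne (zero_le.antisymm (ht.2 hs.1 zero_le))
  obtain ⟨i, hi⟩ := hsupp ht hs hne
  obtain ⟨j, hj⟩ := hsupp hs ht hne.symm
  refine mul_ι_single_notMem_range ha hdisj (fun u hu hle => ?_) hi hj
    (HasTrivialMasseyOperation.mul_mem_range _ hG (ι_single_mem_koszulCycles hs.1 hi)
      (ι_single_mem_koszulCycles ht.1 hj))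
  by_contra! h
  exact hno u hu h.1 h.2 (hsup ▸ hle)
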